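/- Let $\Omega\subset\mathbb R^3$ be a bounded domain and let $\Gamma$ be a closed (compact) $C^2$ surface contained in $\Omega$ that encloses an open region $\Omega^-$, with $\overline{\Omega^-}\subset\Omega$ and $\Gamma=\partial\Omega^-$; put $\Omega^+=\Omega\setminus\overline{\Omega^-}$, and let $\mathbf n$ be the unit normal of $\Gamma$ pointing from $\Omega^-$ into $\Omega^+$. For a field $w$ and $x\in\Gamma$, the jump of $w$ at $x$ is $$[w]=\lim_{\epsilon\to0^+}w(x+\epsilon\mathbf n(x))-\lim_{\epsilon\to0^+}w(x-\epsilon\mathbf n(x)).$$ For functions on $\Gamma$, let $\partial/\partial\mathbf v$ be the derivative along a tangent vector $\mathbf v$, let $\nabla_s=(\mathbf I-\mathbf n\otimes\mathbf n)\nabla$ be the surface gradient, $\nabla_s\cdot$ the surface divergence, and $\nabla_s^2=\nabla_s\cdot\nabla_s$ the surface Laplacian (applied to vector fields componentwise). Let $H=\nabla_s\cdot\mathbf n$ be the total curvature. Let $\mathbf t,\mathbf b$ be principal directions of $\Gamma$ at $x$ such that $(\mathbf n,\mathbf t,\mathbf b)$ is orthonormal, and let $\kappa_t,\kappa_b$ be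 the corresponding principal curvatures, with the sign convention $\partial\mathbf n/\partial t=\kappa_t\mathbf t$, $\partial\mathbf n/\partial b=\kappa_b\mathbf b$ (so $H=\kappa_t+\kappa_b$). Let the viscosity $\mu$ be equal to a constant $\mu^\pm$ in $\Omega^\pm$. Let the velocity $\mathbf u$ be continuous on $\Omega$ and $C^2$ up to $\Gamma$ on each side of $\Gamma$, let the pressure $p$ be $C^1$ up to $\Gamma$ on each side (possibly discontinuous across $\Gamma$), let $\mathbf g$ be a body force, and let $\mathbf q=\mathbf u|_\Gamma$. Suppose that $$\nabla p=\mu\nabla^2\mathbf u+\mathbf g,\qquad \nabla\cdot\mathbf u=0\qquad\text{in }\Omega^-\cup\Omega^+,$$ $$\nabla_s\cdot\mathbf q=0\quad\text{and}\quad[\boldsymbol\sigma]\,\mathbf n=\mathbf f\quad\text{on }\Gamma,\qquad \boldsymbol\sigma=-p\,\mathbf I+\mu\left(\nabla\mathbf u+(\nabla\mathbf u)^T\right),$$ where $\mathbf f$ is a force density on $\Gamma$. Then at every point of $\Gamma$ the jumps and surface derivatives below exist, and the jump in the normal derivative of the pressure is $$\left[\frac{\partial p}{\partial n}\right]=\left[\mu\nabla^2\mathbf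 u\right]\cdot\mathbf n+[\mathbf g]\cdot\mathbf n,$$ or, alternatively, $$\left[\frac{\partial p}{\partial n}\right]=2[\mu]\left(\mathbf n\cdot\nabla_s^2\mathbf q+\kappa_t\frac{\partial\mathbf q}{\partial t}\cdot\mathbf t+\kappa_b\frac{\partial\mathbf q}{\partial b}\cdot\mathbf b\right)-\nabla_s\cdot\mathbf f+(\mathbf f\cdot\mathbf n)H+[\mathbf g]\cdot\mathbf n,$$ where $[\mu]=\mu^+-\mu^-$. -/

import Mathlib

open Set Filter Topology InnerProductSpace

/-- Three-dimensional Euclidean space. -/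
abbrev E3 : Type := EuclideanSpace ℝ (Fin 3)

/-! ## Geometry of the interface -/

/-- `φ` is a `C²` defining function on the open set `U` for an interface `Γ` separating `Ωm`
(where `φ < 0`) from `Ωp` (where `φ > 0`). -/
structure IsDefiningFunction (Ωm Ωp Γ U : Set E3) (φ : E3 → ℝ) : Prop where
  isOpen : IsOpen U
  contDiffOn : ContDiffOn ℝ 2 φ U
  gradient_ne_zero : ∀ y ∈ U, gradient φ y ≠ 0
  mem_minus : ∀ y ∈ U, (y ∈ Ωm ↔ φ y < 0)
  mem_interface : ∀ y ∈ U, (y ∈ Γ ↔ φ y = 0)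
  mem_plus : ∀ y ∈ U, (y ∈ Ωp ↔ 0 < φ y)

/-- A bounded domain `Ω` containing a closed interface `Γ` of class `C²`, wholly inside `Ω`, that
encloses the region `Ωm` and leaves `Ωp` outside; `n` is the unit normal field of `Γ` pointing
from `Ωm` into `Ωp`.  (Values of `n` off `Γ` are irrelevant.) -/
structure IsTwoPhaseDomain (Ω Ωm Ωp Γ : Set E3) (n : E3 → E3) : Prop where
  isOpen : IsOpen Ω
  isConnected : IsConnected Ω
  isBounded : Bornology.IsBounded Ω
  isOpen_minus : IsOpen Ωm
  closure_minus_subset : closure Ωm ⊆ Ω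
  interface_eq : Γ = frontier Ωm
  plus_eq : Ωp = Ω \ closure Ωm
  exists_defining : ∀ x ∈ Γ, ∃ (U : Set E3) (φ : E3 → ℝ), x ∈ U ∧
    IsDefiningFunction Ωm Ωp Γ U φ ∧
    ∀ y ∈ U ∩ Γ, n y = ‖gradient φ y‖⁻¹ • gradient φ y

/-! ## Surface differential operators

They act on functions through their restriction to `Γ` only: a derivative of `h` within `Γ` at `x`
is determined on the tangent plane of `Γ` at `x`, and it is composed with the projection onto that
plane. -/

section Surface

variable {F : Type*} [NormedAddCommGroup F] [NormedSpace ℝ F]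

/-- The tangential projection `P = I - n ⊗ n` at `x`. -/
noncomputable def tangentProj (n : E3 → E3) (x : E3) : E3 →L[ℝ] E3 :=
  ContinuousLinearMap.id ℝ E3 - (innerSL ℝ (n x)).smulRight (n x)

/-- The surface derivative of `h` along `Γ` at `x`: it sends a tangent vector `v` to `∂h/∂v` and
the normal vector to `0`. -/
noncomputable def surfDeriv (Γ : Set E3) (n : E3 → E3) (h : E3 → F) (x : E3) : E3 →L[ℝ] F :=
  (fderivWithin ℝ h Γ x).comp (tangentProj n x)

/-- The surface gradient `∇_s h` of a scalar function. -/
noncomputable def surfGrad (Γ : Set E3) (n : E3 → E3) (h : E3 → ℝ) (x : E3) : E3 :=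
  (toDual ℝ E3).symm (surfDeriv Γ n h x)

/-- The surface divergence `∇_s · v` of a (not necessarily tangential) vector field. -/
noncomputable def surfDiv (Γ : Set E3) (n : E3 → E3) (v : E3 → E3) (x : E3) : ℝ :=
  LinearMap.trace ℝ E3 (surfDeriv Γ n v x).toLinearMap

/-- The surface Laplacian `∇_s² h = ∇_s · ∇_s h` of a scalar function. -/
noncomputable def surfLaplacian (Γ : Set E3) (n : E3 → E3) (h : E3 → ℝ) (x : E3) : ℝ :=
  surfDiv Γ n (surfGrad Γ n h) x

/-- The surface Laplacian of a vector field, taken on each Cartesian component. -/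
noncomputable def surfVecLaplacian (Γ : Set E3) (n : E3 → E3) (v : E3 → E3) (x : E3) : E3 :=
  WithLp.toLp 2 fun i => surfLaplacian Γ n (fun y => v y i) x

/-- The total curvature `H = ∇_s · n`, i.e. the sum of the principal curvatures (`2 / R` on a
sphere of radius `R` with normal pointing away from the centre). -/
noncomputable def totalCurvature (Γ : Set E3) (n : E3 → E3) (x : E3) : ℝ :=
  surfDiv Γ n n x

/-- `(n x, t, b)` is orthonormal and `t`, `b` are principal directions of `Γ` at `x` with
principal curvatures `κt`, `κb`: `∂n/∂t = κt t` and `∂n/∂b = κb b`. -/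
structure IsPrincipalFrame (Γ : Set E3) (n : E3 → E3) (x t b : E3) (κt κb : ℝ) : Prop where
  orthonormal : Orthonormal ℝ ![n x, t, b]
  deriv_t : surfDeriv Γ n n x t = κt • t
  deriv_b : surfDeriv Γ n n x b = κb • b

end Surface

/-! ## Piecewise smooth fields and jumps -/

section Jump

variable {F : Type*} [NormedAddCommGroup F] [NormedSpace ℝ F]

/-- On each side of `Γ`, the field `w` is of class `C^k` up to `Γ`: its restrictions to `Ωm` and to
`Ωp` extend to `C^k` functions on `Ωm ∪ Γ` and on `Ωp ∪ Γ`. -/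
def IsPiecewiseContDiff (k : ℕ) (Ωm Ωp Γ : Set E3) (w : E3 → F) : Prop :=
  (∃ wm : E3 → F, ContDiffOn ℝ k wm (Ωm ∪ Γ) ∧ EqOn w wm Ωm) ∧
  (∃ wp : E3 → F, ContDiffOn ℝ k wp (Ωp ∪ Γ) ∧ EqOn w wp Ωp)

/-- The jump `[w]` at `x` in the direction of the normal `ν` exists and equals `J`:
`J = lim_{ε → 0+} w (x + ε ν) - lim_{ε → 0+} w (x - ε ν)`, with both limits existing. -/
def HasJump (w : E3 → F) (x ν : E3) (J : F) : Prop :=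
  ∃ a b : F, Tendsto (fun ε : ℝ => w (x + ε • ν)) (𝓝[>] 0) (𝓝 a) ∧
    Tendsto (fun ε : ℝ => w (x - ε • ν)) (𝓝[>] 0) (𝓝 b) ∧ J = a - b

end Jump

/-! ## The two-phase Stokes system -/

/-- The stress tensor `σ = -p I + μ (∇u + (∇u)ᵀ)`. -/
noncomputable def stress (μ p : E3 → ℝ) (u : E3 → E3) (y : E3) : E3 →L[ℝ] E3 :=
  -(p y • ContinuousLinearMap.id ℝ E3) +
    μ y • (fderiv ℝ u y + ContinuousLinearMap.adjoint (fderiv ℝ u y))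

/-- A solution of the Stokes equations on both sides of an incompressible interface `Γ` with
viscosity `μm` in `Ωm` and `μp` in `Ωp`, velocity `u`, pressure `p`, body force `g`, singular
interface force `f` and interface velocity `q`. -/
structure IsStokesFlow (Ω Ωm Ωp Γ : Set E3) (n : E3 → E3) (μm μp : ℝ) (μ : E3 → ℝ)
    (u : E3 → E3) (p : E3 → ℝ) (g f q : E3 → E3) : Prop where
  viscosity_minus : ∀ y ∈ Ωm, μ y = μm
  viscosity_plus : ∀ y ∈ Ωp, μ y = μp
  velocity_regular : IsPiecewiseContDiff 2 Ωm Ωp Γ u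
  velocity_continuous : ContinuousOn u Ω
  pressure_regular : IsPiecewiseContDiff 1 Ωm Ωp Γ p
  momentum : ∀ y ∈ Ωm ∪ Ωp, gradient p y = μ y • Laplacian.laplacian u y + g y
  incompressible : ∀ y ∈ Ωm ∪ Ωp, LinearMap.trace ℝ E3 (fderiv ℝ u y).toLinearMap = 0
  interface_velocity : ∀ x ∈ Γ, q x = u x
  interface_incompressible : ∀ x ∈ Γ, surfDiv Γ n q x = 0
  stress_balance : ∀ x ∈ Γ, HasJump (fun y => stress μ p u y (n x)) x (n x) (f x)

/-! Dotting the momentum equation with the normal and taking jumps gives the first formula. The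
second follows from an identity valid on each side separately: with `m` the viscosity and `F = -P n
+ m (A + Aᵀ) n` the one-sided traction, m Δu·n = 2m (n·∇_s²q + κt ∂q/∂t·t + κb ∂q/∂b·b) - ∇_s·F +
(F·n) H. Here `A`, `B` are the first and second derivatives of the `C²` extension of `u`. In the
frame `(n, t, b)`, ∇_s·F contains t·B(t,n) + b·B(b,n), which equals -n·B(n,n) by symmetry of `B` and
the normal derivative of div u = 0. The remaining second-order part n·B(t,t) + n·B(b,b) is n·∇_s²q +
H n·A n. Since `q` agrees with both extensions on `Γ`, its surface derivatives are common to the two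
sides, and subtracting the identities leaves the factor [μ]. The carriers are
`IsPrincipalFrame.exists_traction_surfDiv`, `IsPrincipalFrame.surfVecLaplacian_eq` and
`IsSide.sum_inner_fderivWithin_fderivWithin_eq_zero`. -/

/-- `D` is an open region lying on one side of the surface `Γ`, and `n` is the unit normal of `Γ`
pointing into `D`. -/
structure IsSide (D Γ : Set E3) (n : E3 → E3) : Prop where
  isOpen : IsOpen D
  exists_defining : ∀ x ∈ Γ, ∃ (U : Set E3) (φ : E3 → ℝ), x ∈ U ∧ IsOpen U ∧
    ContDiffOn ℝ 2 φ U ∧ (∀ y ∈ U, gradient φ y ≠ 0) ∧ (∀ y ∈ U, (y ∈ D ↔ 0 < φ y)) ∧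
    (∀ y ∈ U, (y ∈ Γ ↔ φ y = 0)) ∧ ∀ y ∈ U ∩ Γ, n y = ‖gradient φ y‖⁻¹ • gradient φ y

theorem IsTwoPhaseDomain.isSide_plus {Ω Ωm Ωp Γ : Set E3} {n : E3 → E3}
    (h : IsTwoPhaseDomain Ω Ωm Ωp Γ n) : IsSide Ωp Γ n where
  isOpen := by
    rw [h.plus_eq]
    exact h.isOpen.sdiff isClosed_closure
  exists_defining x hx := by
    obtain ⟨U, φ, hxU, hφ, hn⟩ := h.exists_defining x hx
    exact ⟨U, φ, hxU, hφ.isOpen, hφ.contDiffOn, hφ.gradient_ne_zero, hφ.mem_plus,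
      hφ.mem_interface, hn⟩

theorem gradient_neg_fun (φ : E3 → ℝ) (y : E3) :
    gradient (fun z => -φ z) y = -gradient φ y := by
  simp only [gradient, fderiv_fun_neg, map_neg]

/-- Reversing the signs of `φ` and `n` lets one one-sided theory serve both phases. -/
theorem IsTwoPhaseDomain.isSide_minus {Ω Ωm Ωp Γ : Set E3} {n : E3 → E3}
    (h : IsTwoPhaseDomain Ω Ωm Ωp Γ n) : IsSide Ωm Γ (fun y => -n y) where
  isOpen := h.isOpen_minus
  exists_defining x hx := by
    obtain ⟨U, φ, hxU, hφ, hn⟩ := h.exists_defining x hx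
    refine ⟨U, fun z => -φ z, hxU, hφ.isOpen, hφ.contDiffOn.neg, fun y hy => ?_, fun y hy => ?_,
      fun y hy => ?_, fun y hy => ?_⟩
    · rw [gradient_neg_fun, neg_ne_zero]
      exact hφ.gradient_ne_zero y hy
    · rw [hφ.mem_minus y hy, neg_pos]
    · rw [hφ.mem_interface y hy, neg_eq_zero]
    · rw [gradient_neg_fun, norm_neg, smul_neg, hn y hy]

/-- Moving from a zero of `φ` in a direction of positive slope, `φ` becomes positive. -/
theorem eventually_pos_of_fderiv_pos {φ : E3 → ℝ} {x v : E3} (hφ : DifferentiableAt ℝ φ x)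
    (h0 : φ x = 0) (hv : 0 < fderiv ℝ φ x v) :
    ∀ᶠ ε : ℝ in 𝓝[>] 0, 0 < φ (x + ε • v) := by
  have hd : HasDerivAt (fun ε : ℝ => φ (x + ε • v)) (fderiv ℝ φ x v) 0 := by
    have h1 : HasFDerivAt φ (fderiv ℝ φ x) (x + (0 : ℝ) • v) := by
      simpa using hφ.hasFDerivAt
    have h2 : HasDerivAt (fun ε : ℝ => x + ε • v) v 0 := by
      simpa using ((hasDerivAt_id (0 : ℝ)).smul_const v).const_add x
    exact h1.comp_hasDerivAt (0 : ℝ) h2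
  have ht := (hd.tendsto_slope.mono_left (nhdsWithin_mono _ fun t (ht : 0 < t) => ht.ne')).eventually
    (lt_mem_nhds hv)
  filter_upwards [ht, self_mem_nhdsWithin] with ε hε (hpos : 0 < ε)
  rw [slope_def_field] at hε
  simp only [zero_smul, add_zero, h0, sub_zero] at hε
  exact (div_pos_iff_of_pos_right hpos).1 hε

theorem tendsto_add_smul (x v : E3) :
    Tendsto (fun ε : ℝ => x + ε • v) (𝓝[>] 0) (𝓝 x) := by
  have : Continuous (fun ε : ℝ => x + ε • v) := by fun_prop
  simpa using (this.tendsto 0).mono_left nhdsWithin_le_nhds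

theorem inner_gradient_eq (φ : E3 → ℝ) (x v : E3) :
    inner ℝ (gradient φ x) v = fderiv ℝ φ x v := by
  simp [gradient]

/-! ### Tangent cones and derivatives along the interface -/

namespace IsSide

variable {D Γ : Set E3} {n : E3 → E3}

theorem norm_normal (h : IsSide D Γ n) {x : E3} (hx : x ∈ Γ) : ‖n x‖ = 1 := by
  obtain ⟨U, φ, hxU, -, -, hne, -, -, hn⟩ := h.exists_defining x hx
  rw [hn x ⟨hxU, hx⟩]
  exact norm_smul_inv_norm (𝕜 := ℝ) (hne x hxU)

/-- All directions of the open half-space are needed, not only the normal: they make the tangent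
cone of `D` large enough for unique differentiability. -/
theorem eventually_mem_of_inner_pos (h : IsSide D Γ n) {x v : E3} (hx : x ∈ Γ)
    (hv : 0 < inner ℝ (n x) v) : ∀ᶠ ε : ℝ in 𝓝[>] 0, x + ε • v ∈ D := by
  obtain ⟨U, φ, hxU, hU, hφ, hne, hD, hG, hn⟩ := h.exists_defining x hx
  have hd : DifferentiableAt ℝ φ x :=
    (hφ.contDiffAt (hU.mem_nhds hxU)).differentiableAt (by norm_num)
  rw [hn x ⟨hxU, hx⟩, inner_smul_left, inner_gradient_eq] at hv
  have hpos : 0 < fderiv ℝ φ x v :=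
    pos_of_mul_pos_right hv (by simp)
  filter_upwards [eventually_pos_of_fderiv_pos hd ((hG x hxU).1 hx) hpos,
    (tendsto_add_smul x v).eventually (hU.mem_nhds hxU)] with ε h1 h2
  exact (hD _ h2).2 h1

theorem eventually_mem (h : IsSide D Γ n) {x : E3} (hx : x ∈ Γ) :
    ∀ᶠ ε : ℝ in 𝓝[>] 0, x + ε • n x ∈ D :=
  h.eventually_mem_of_inner_pos hx (by simp [h.norm_normal hx])

theorem tendsto_nhdsWithin (h : IsSide D Γ n) {x : E3} (hx : x ∈ Γ) :
    Tendsto (fun ε : ℝ => x + ε • n x) (𝓝[>] 0) (𝓝[D] x) :=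
  tendsto_nhdsWithin_iff.2 ⟨tendsto_add_smul x (n x), h.eventually_mem hx⟩

theorem mem_closure (h : IsSide D Γ n) {x : E3} (hx : x ∈ Γ) : x ∈ closure D :=
  mem_closure_of_tendsto (tendsto_add_smul x (n x)) (h.eventually_mem hx)

theorem mem_closure_interior (h : IsSide D Γ n) {x : E3} (hx : x ∈ D ∪ Γ) :
    x ∈ closure (interior (D ∪ Γ)) := by
  have hsub : closure D ⊆ closure (interior (D ∪ Γ)) :=
    closure_mono (interior_maximal subset_union_left h.isOpen)
  rcases hx with hx | hx
  · exact hsub (subset_closure hx)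
  · exact hsub (h.mem_closure hx)

/-- At a point of `Γ` the tangent cone of `D` contains an open half-space, hence spans. This makes
one-sided derivatives at the interface well defined. -/
theorem uniqueDiffOn (h : IsSide D Γ n) : UniqueDiffOn ℝ (D ∪ Γ) := by
  rintro x (hx | hx)
  · exact (h.isOpen.uniqueDiffWithinAt hx).mono subset_union_left
  refine UniqueDiffWithinAt.mono ⟨?_, h.mem_closure hx⟩ (subset_union_left (t := Γ))
  have hsub : {v : E3 | 0 < inner ℝ (n x) v} ⊆ tangentConeAt ℝ D x := fun v hv =>
    mem_tangentConeAt_of_add_smul_mem (l := 𝓝[>] (0 : ℝ)) (c := fun ε => ε)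
      (tendsto_id.mono_right (nhdsWithin_mono _ fun t (ht : 0 < t) => ht.ne'))
      (h.eventually_mem_of_inner_pos hx hv)
  have hopen : IsOpen {v : E3 | 0 < inner ℝ (n x) v} :=
    isOpen_lt continuous_const (by fun_prop)
  have htop : Submodule.span ℝ (tangentConeAt ℝ D x) = ⊤ := by
    refine Submodule.eq_top_of_nonempty_interior' _ ⟨n x, ?_⟩
    refine interior_maximal (hsub.trans Submodule.subset_span) hopen ?_
    simp [h.norm_normal hx]
  rw [htop]
  exact dense_univ

/-- The tangent plane of `Γ` consists of tangent vectors of curves in `Γ`. -/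
theorem mem_tangentConeAt (h : IsSide D Γ n) {x v : E3} (hx : x ∈ Γ)
    (hv : inner ℝ (n x) v = 0) : v ∈ tangentConeAt ℝ Γ x := by
  obtain ⟨U, φ, hxU, hU, hφ, hne, hD, hG, hn⟩ := h.exists_defining x hx
  have hstrict : HasStrictFDerivAt φ (fderiv ℝ φ x) x :=
    (hφ.contDiffAt (hU.mem_nhds hxU)).hasStrictFDerivAt (by norm_num)
  have hker : fderiv ℝ φ x v = 0 := by
    rw [hn x ⟨hxU, hx⟩, inner_smul_left, inner_gradient_eq] at hv
    exact (mul_eq_zero.1 hv).resolve_left (by simpa using hne x hxU)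
  have hrange : (fderiv ℝ φ x : E3 →L[ℝ] ℝ).range = ⊤ := by
    apply LinearMap.range_eq_top.2
    apply LinearMap.surjective
    intro h0
    apply hne x hxU
    have : fderiv ℝ φ x = 0 := by
      ext w
      exact congrArg (fun l : E3 →ₗ[ℝ] ℝ => l w) h0
    simp [gradient, this]
  have hx0 : φ x = 0 := (hG x hxU).1 hx
  -- The implicit function theorem parametrizes the level set of `φ` by the kernel of its
  -- derivative; the line through `v` there becomes a curve in `Γ` with velocity `v`.
  let γ : ℝ → E3 := fun t =>
    hstrict.implicitFunction φ (fderiv ℝ φ x) hrange (φ x) (t • ⟨v, hker⟩)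
  have hγ0 : γ 0 = x := by
    simp only [γ, zero_smul]
    exact hstrict.implicitFunction_apply_image hrange
  have hlin : HasDerivAt (fun t : ℝ => t • (⟨v, hker⟩ : (fderiv ℝ φ x).ker)) ⟨v, hker⟩ 0 := by
    simpa using (hasDerivAt_id (0 : ℝ)).smul_const (⟨v, hker⟩ : (fderiv ℝ φ x).ker)
  have hlin0 : Tendsto (fun t : ℝ => t • (⟨v, hker⟩ : (fderiv ℝ φ x).ker)) (𝓝 0) (𝓝 0) := by
    simpa using hlin.continuousAt.tendsto
  have hγ : HasDerivAt γ v 0 := by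
    have h1 : HasFDerivAt (hstrict.implicitFunction φ (fderiv ℝ φ x) hrange (φ x))
        (fderiv ℝ φ x).ker.subtypeL ((0 : ℝ) • (⟨v, hker⟩ : (fderiv ℝ φ x).ker)) := by
      rw [zero_smul]
      exact (hstrict.to_implicitFunction hrange).hasFDerivAt
    exact h1.comp_hasDerivAt (0 : ℝ) hlin
  have hmem : ∀ᶠ t in 𝓝 (0 : ℝ), γ t ∈ Γ := by
    have h1 : ∀ᶠ t in 𝓝 (0 : ℝ), φ (γ t) = φ x :=
      (tendsto_const_nhds.prodMk_nhds hlin0).eventually (hstrict.map_implicitFunction_eq hrange)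
    have h2 : ∀ᶠ t in 𝓝 (0 : ℝ), γ t ∈ U :=
      hγ.continuousAt.eventually (by rw [hγ0]; exact hU.mem_nhds hxU)
    filter_upwards [h1, h2] with t ht1 ht2
    exact (hG _ ht2).2 (ht1.trans hx0)
  refine mem_tangentConeAt_of_seq (𝓝[≠] (0 : ℝ)) (fun t => t⁻¹) (fun t => γ t - x) ?_ ?_ ?_
  · have := hγ.continuousAt.tendsto.sub_const x
    rw [hγ0, sub_self] at this
    exact this.mono_left nhdsWithin_le_nhds
  · filter_upwards [nhdsWithin_le_nhds hmem] with t ht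
    simpa using ht
  · simpa [slope_fun_def, hγ0] using hγ.tendsto_slope

/-- A derivative within `Γ` is determined only on the tangent plane, and `tangentProj` discards the
rest. Hence the derivative of any extension computes the surface derivative. -/
theorem surfDeriv_eq {F : Type*} [NormedAddCommGroup F] [NormedSpace ℝ F] (h : IsSide D Γ n)
    {x : E3} (hx : x ∈ Γ) {w : E3 → F} {L : E3 →L[ℝ] F} (hw : HasFDerivWithinAt w L Γ x) :
    surfDeriv Γ n w x = L.comp (tangentProj n x) := by
  ext v
  simp only [surfDeriv, ContinuousLinearMap.comp_apply]
  refine hw.differentiableWithinAt.hasFDerivWithinAt.unique_on hw (h.mem_tangentConeAt hx ?_)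
  simp [tangentProj, inner_sub_right, inner_smul_right, h.norm_normal hx]

theorem differentiableWithinAt_normal (h : IsSide D Γ n) {x : E3} (hx : x ∈ Γ) :
    DifferentiableWithinAt ℝ n Γ x := by
  obtain ⟨U, φ, hxU, hU, hφ, hne, hD, hG, hn⟩ := h.exists_defining x hx
  have hc : ContDiffAt ℝ 1 (fderiv ℝ φ) x :=
    (hφ.contDiffAt (hU.mem_nhds hxU)).fderiv_right (by norm_num)
  have hgrad : DifferentiableAt ℝ (gradient φ) x :=
    (toDual ℝ E3).symm.toContinuousLinearEquiv.differentiableAt.comp x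
      (hc.differentiableAt (by norm_num))
  have hd : DifferentiableAt ℝ (fun y => ‖gradient φ y‖⁻¹ • gradient φ y) x :=
    ((hgrad.norm ℝ (hne x hxU)).inv (norm_ne_zero_iff.2 (hne x hxU))).smul hgrad
  refine hd.differentiableWithinAt.congr_of_eventuallyEq ?_ (hn x ⟨hxU, hx⟩)
  filter_upwards [self_mem_nhdsWithin, mem_nhdsWithin_of_mem_nhds (hU.mem_nhds hxU)] with y h1 h2
  exact hn y ⟨h2, h1⟩

end IsSide

/-! ### One-sided extensions and their derivatives up to the interface -/

namespace IsSide

variable {D Γ : Set E3} {n : E3 → E3}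

theorem tendsto_of_eqOn (h : IsSide D Γ n) {F : Type*} [TopologicalSpace F] {x : E3} (hx : x ∈ Γ)
    {w W : E3 → F} (hW : ContinuousOn W (D ∪ Γ)) (hw : EqOn w W D) :
    Tendsto (fun ε : ℝ => w (x + ε • n x)) (𝓝[>] 0) (𝓝 (W x)) := by
  have h1 : Tendsto W (𝓝[D] x) (𝓝 (W x)) :=
    (hW x (Or.inr hx)).mono_left (nhdsWithin_mono _ subset_union_left)
  refine (h1.comp (h.tendsto_nhdsWithin hx)).congr' ?_
  filter_upwards [h.eventually_mem hx] with ε hε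
  exact (hw hε).symm

variable {F : Type*} [NormedAddCommGroup F] [NormedSpace ℝ F]

theorem fderiv_eqOn (h : IsSide D Γ n) {w W : E3 → F} (hw : EqOn w W D) :
    EqOn (fderiv ℝ w) (fderivWithin ℝ W (D ∪ Γ)) D := fun y hy => by
  have hD : D ∈ 𝓝 y := h.isOpen.mem_nhds hy
  rw [fderivWithin_of_mem_nhds (mem_of_superset hD subset_union_left)]
  exact (hw.eventuallyEq_of_mem hD).fderiv_eq

/-- The orthonormal basis is left free so that the Laplacian can later be expanded in the principal
frame. -/
theorem laplacian_eqOn (h : IsSide D Γ n) {w W : E3 → F} (hw : EqOn w W D) {ι : Type*} [Fintype ι]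
    (e : OrthonormalBasis ι ℝ E3) :
    EqOn (Laplacian.laplacian w)
      (fun y => ∑ i, fderivWithin ℝ (fderivWithin ℝ W (D ∪ Γ)) (D ∪ Γ) y (e i) (e i)) D :=
  fun y hy => by
    rw [laplacian_eq_iteratedFDeriv_orthonormalBasis w e]
    simp only [iteratedFDeriv_two_apply, Matrix.cons_val_zero, Matrix.cons_val_one]
    rw [h.fderiv_eqOn (h.fderiv_eqOn hw) hy]

theorem contDiffOn_fderivWithin (h : IsSide D Γ n) {W : E3 → F} (hW : ContDiffOn ℝ 2 W (D ∪ Γ)) :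
    ContDiffOn ℝ 1 (fderivWithin ℝ W (D ∪ Γ)) (D ∪ Γ) :=
  hW.fderivWithin h.uniqueDiffOn (by norm_num)

theorem continuousOn_fderivWithin (h : IsSide D Γ n) {W : E3 → F}
    (hW : ContDiffOn ℝ 1 W (D ∪ Γ)) :
    ContinuousOn (fderivWithin ℝ W (D ∪ Γ)) (D ∪ Γ) :=
  hW.continuousOn_fderivWithin h.uniqueDiffOn le_rfl

theorem hasFDerivWithinAt {W : E3 → F} (hW : ContDiffOn ℝ 1 W (D ∪ Γ)) {x : E3} (hx : x ∈ Γ) :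
    HasFDerivWithinAt W (fderivWithin ℝ W (D ∪ Γ) x) Γ x :=
  ((hW.differentiableOn (by norm_num) x (Or.inr hx)).hasFDerivWithinAt).mono subset_union_right

/-- Points of `Γ` are limits of interior points, so symmetry persists there. It reconciles the
B(t,n) of the traction with the B(n,t) of the divergence. -/
theorem fderivWithin_fderivWithin_symm (h : IsSide D Γ n) {W : E3 → F}
    (hW : ContDiffOn ℝ 2 W (D ∪ Γ)) {x : E3} (hx : x ∈ Γ) (v w : E3) :
    fderivWithin ℝ (fderivWithin ℝ W (D ∪ Γ)) (D ∪ Γ) x v w =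
      fderivWithin ℝ (fderivWithin ℝ W (D ∪ Γ)) (D ∪ Γ) x w v :=
  (hW x (Or.inr hx)).isSymmSndFDerivWithinAt (by simp) h.uniqueDiffOn
    (h.mem_closure_interior (Or.inr hx)) (Or.inr hx) v w

/-- A solenoidal field remains solenoidal up to the boundary. -/
theorem sum_inner_fderivWithin_eq_zero (h : IsSide D Γ n) {w W : E3 → E3}
    (hW : ContDiffOn ℝ 1 W (D ∪ Γ)) (hw : EqOn w W D)
    (hdiv : ∀ y ∈ D, LinearMap.trace ℝ E3 (fderiv ℝ w y).toLinearMap = 0)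
    {ι : Type*} [Fintype ι] (e : OrthonormalBasis ι ℝ E3) {x : E3} (hx : x ∈ D ∪ Γ) :
    ∑ i, inner ℝ (e i) (fderivWithin ℝ W (D ∪ Γ) x (e i)) = 0 := by
  have hD : ∀ y ∈ D, ∑ i, inner ℝ (e i) (fderivWithin ℝ W (D ∪ Γ) y (e i)) = 0 := fun y hy => by
    rw [← h.fderiv_eqOn hw hy, ← hdiv y hy, LinearMap.trace_eq_sum_inner _ e]
    rfl
  rcases hx with hx | hx
  · exact hD x hx
  have hc : ContinuousOn (fun y => ∑ i, inner ℝ (e i) (fderivWithin ℝ W (D ∪ Γ) y (e i)))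
      (D ∪ Γ) :=
    continuousOn_finsetSum _ fun i _ => continuousOn_const.inner
      ((h.continuousOn_fderivWithin hW).clm_apply continuousOn_const)
  exact tendsto_nhds_unique (h.tendsto_of_eqOn (w := fun _ => (0 : ℝ)) hx hc
    fun y hy => (hD y hy).symm) tendsto_const_nhds

/-- The derivative of the divergence of a solenoidal field vanishes up to the boundary. -/
theorem sum_inner_fderivWithin_fderivWithin_eq_zero (h : IsSide D Γ n) {w W : E3 → E3}
    (hW : ContDiffOn ℝ 2 W (D ∪ Γ)) (hw : EqOn w W D)
    (hdiv : ∀ y ∈ D, LinearMap.trace ℝ E3 (fderiv ℝ w y).toLinearMap = 0)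
    {ι : Type*} [Fintype ι] (e : OrthonormalBasis ι ℝ E3) {x : E3} (hx : x ∈ Γ) (v : E3) :
    ∑ i, inner ℝ (e i) (fderivWithin ℝ (fderivWithin ℝ W (D ∪ Γ)) (D ∪ Γ) x v (e i)) = 0 := by
  have hxS : x ∈ D ∪ Γ := Or.inr hx
  have hd : HasFDerivWithinAt (fderivWithin ℝ W (D ∪ Γ))
      (fderivWithin ℝ (fderivWithin ℝ W (D ∪ Γ)) (D ∪ Γ) x) (D ∪ Γ) x :=
    ((h.contDiffOn_fderivWithin hW).differentiableOn (by norm_num) x hxS).hasFDerivWithinAt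
  let T : (E3 →L[ℝ] E3) →L[ℝ] ℝ :=
    ∑ i, (innerSL ℝ (e i)).comp (ContinuousLinearMap.apply ℝ E3 (e i))
  have hT : ∀ A : E3 →L[ℝ] E3, T A = ∑ i, inner ℝ (e i) (A (e i)) := fun A => by
    simp [T]
  have h1 := T.hasFDerivAt.comp_hasFDerivWithinAt x hd
  have h2 : HasFDerivWithinAt (T ∘ fderivWithin ℝ W (D ∪ Γ)) (0 : E3 →L[ℝ] ℝ) (D ∪ Γ) x := by
    refine (hasFDerivWithinAt_const (0 : ℝ) x (D ∪ Γ)).congr (fun y hy => ?_) ?_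
    · rw [Function.comp_apply, hT]
      exact h.sum_inner_fderivWithin_eq_zero (hW.of_le (by norm_num)) hw hdiv e hy
    · rw [Function.comp_apply, hT]
      exact h.sum_inner_fderivWithin_eq_zero (hW.of_le (by norm_num)) hw hdiv e hxS
  -- The divergence vanishes on all of `D ∪ Γ`, so unique differentiability forces its derivative to
  -- be zero in every direction, the normal included.
  have h3 := (h.uniqueDiffOn x hxS).eq h1 h2
  rw [← hT]
  exact congrArg (fun l : E3 →L[ℝ] ℝ => l v) h3

end IsSide

/-! ### Surface derivatives of tractions and surface gradients -/

/-- The adjoint of a field of operators is differentiable along with the field. -/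
theorem exists_hasFDerivWithinAt_adjoint_apply {Γ : Set E3} {x : E3} {A : E3 → E3 →L[ℝ] E3}
    {B : E3 →L[ℝ] E3 →L[ℝ] E3} (hA : HasFDerivWithinAt A B Γ x) {n : E3 → E3} {N : E3 →L[ℝ] E3}
    (hn : HasFDerivWithinAt n N Γ x) :
    ∃ L : E3 →L[ℝ] E3,
      HasFDerivWithinAt (fun y => ContinuousLinearMap.adjoint (A y) (n y)) L Γ x ∧
      ∀ v z, inner ℝ z (L v) = inner ℝ (B v z) (n x) + inner ℝ (A x z) (N v) := by
  -- Over the reals the conjugate-linear adjoint is linear, and it preserves the norm, whence the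
  -- bound 1.
  let adj : (E3 →L[ℝ] E3) →L[ℝ] (E3 →L[ℝ] E3) :=
    LinearMap.mkContinuous
      { toFun := fun T => ContinuousLinearMap.adjoint T
        map_add' := fun S T => map_add _ S T
        map_smul' := fun c T => by simp } 1 (fun T => by simp)
  have h1 := (adj.hasFDerivAt.comp_hasFDerivWithinAt x hA).clm_apply hn
  refine ⟨_, h1, fun v z => ?_⟩
  have hadj : ∀ T, adj T = ContinuousLinearMap.adjoint T := fun T => rfl
  simp [hadj, inner_add_right, ContinuousLinearMap.adjoint_inner_right, add_comm]

/-- The surface derivative of the traction `-P n + m (A + Aᵀ) n`. -/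
theorem exists_hasFDerivWithinAt_traction {Γ : Set E3} {x : E3} {P : E3 → ℝ} {π : E3 →L[ℝ] ℝ}
    (hP : HasFDerivWithinAt P π Γ x) {A : E3 → E3 →L[ℝ] E3}
    {B : E3 →L[ℝ] E3 →L[ℝ] E3} (hA : HasFDerivWithinAt A B Γ x) {n : E3 → E3} {N : E3 →L[ℝ] E3}
    (hn : HasFDerivWithinAt n N Γ x) (m : ℝ) :
    ∃ L : E3 →L[ℝ] E3,
      HasFDerivWithinAt (fun y => -(P y • n y) +
        m • (A y (n y) + ContinuousLinearMap.adjoint (A y) (n y))) L Γ x ∧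
      ∀ v z, inner ℝ z (L v) = -(π v * inner ℝ z (n x) + P x * inner ℝ z (N v)) +
        m * (inner ℝ z (B v (n x)) + inner ℝ z (A x (N v)) +
          (inner ℝ (B v z) (n x) + inner ℝ (A x z) (N v))) := by
  obtain ⟨L, hL, hLi⟩ := exists_hasFDerivWithinAt_adjoint_apply hA hn
  refine ⟨_, (hP.smul hn).neg.add (((hA.clm_apply hn).add hL).const_smul m), fun v z => ?_⟩
  simp [inner_add_right, inner_smul_right, hLi]
  ring

/-- The surface gradient of a component of a field, as a tangential projection. -/
theorem surfGrad_eq {D Γ : Set E3} {n : E3 → E3} (h : IsSide D Γ n) {q : E3 → E3} {x : E3}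
    (hx : x ∈ Γ) {A : E3 →L[ℝ] E3} (hq : HasFDerivWithinAt q A Γ x) (i : Fin 3) :
    surfGrad Γ n (fun y => q y i) x =
      (toDual ℝ E3).symm ((EuclideanSpace.proj i).comp A) - (A (n x) i) • n x := by
  have hi : HasFDerivWithinAt (fun y => q y i) ((EuclideanSpace.proj i).comp A) Γ x :=
    (EuclideanSpace.proj (𝕜 := ℝ) i).hasFDerivAt.comp_hasFDerivWithinAt x hq
  refine ext_inner_right ℝ fun v => ?_
  rw [surfGrad, h.surfDeriv_eq hx hi]
  simp [tangentProj, inner_sub_left, inner_smul_left, mul_comm]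

/-- Product rule for ∇q_i - (n·∇q_i) n. This expression must hold along all of `Γ`, since it is
differentiated again. -/
theorem exists_hasFDerivWithinAt_surfGrad {D Γ : Set E3} {n : E3 → E3} (h : IsSide D Γ n)
    {q : E3 → E3} {x : E3} (hx : x ∈ Γ) {A : E3 → E3 →L[ℝ] E3} {B : E3 →L[ℝ] E3 →L[ℝ] E3}
    (hq : ∀ y ∈ Γ, HasFDerivWithinAt q (A y) Γ y) (hA : HasFDerivWithinAt A B Γ x)
    {N : E3 →L[ℝ] E3} (hn : HasFDerivWithinAt n N Γ x) (i : Fin 3) :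
    ∃ L : E3 →L[ℝ] E3, HasFDerivWithinAt (surfGrad Γ n (fun y => q y i)) L Γ x ∧
      ∀ v z, inner ℝ z (L v) = B v z i -
        ((B v (n x) i + A x (N v) i) * inner ℝ z (n x) + A x (n x) i * inner ℝ z (N v)) := by
  have h1 : HasFDerivWithinAt (fun y => (EuclideanSpace.proj (𝕜 := ℝ) i).comp (A y))
      ((ContinuousLinearMap.compL ℝ E3 E3 ℝ (EuclideanSpace.proj i)).comp B) Γ x :=
    (ContinuousLinearMap.compL ℝ E3 E3 ℝ
      (EuclideanSpace.proj i)).hasFDerivAt.comp_hasFDerivWithinAt x hA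
  have h2 := ((toDual ℝ E3).symm.toContinuousLinearEquiv.hasFDerivAt).comp_hasFDerivWithinAt x h1
  have h3 := (EuclideanSpace.proj (𝕜 := ℝ) i).hasFDerivAt.comp_hasFDerivWithinAt x
    (hA.clm_apply hn)
  refine ⟨_, (h2.sub (h3.smul hn)).congr (fun y hy => surfGrad_eq h hy (hq y hy) i)
    (surfGrad_eq h hx (hq x hx) i), fun v z => ?_⟩
  rw [← real_inner_comm]
  simp [inner_sub_left, inner_add_left, inner_smul_left]
  simp only [real_inner_comm]
  ring

/-! ### Computations in a principal frame -/

namespace IsPrincipalFrame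

variable {D Γ : Set E3} {n : E3 → E3} {x t b : E3} {κt κb : ℝ}

theorem exists_orthonormalBasis (hf : IsPrincipalFrame Γ n x t b κt κb) :
    ∃ e : OrthonormalBasis (Fin 3) ℝ E3, e 0 = n x ∧ e 1 = t ∧ e 2 = b := by
  have hspan : Submodule.span ℝ (Set.range ![n x, t, b]) = ⊤ :=
    hf.orthonormal.linearIndependent.span_eq_top_of_card_eq_finrank (by simp)
  exact ⟨OrthonormalBasis.mk hf.orthonormal hspan.ge, by simp, by simp, by simp⟩

theorem inner_normal_t (hf : IsPrincipalFrame Γ n x t b κt κb) : inner ℝ (n x) t = 0 := by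
  simpa using hf.orthonormal.2 (show (0 : Fin 3) ≠ 1 by decide)

theorem inner_normal_b (hf : IsPrincipalFrame Γ n x t b κt κb) : inner ℝ (n x) b = 0 := by
  simpa using hf.orthonormal.2 (show (0 : Fin 3) ≠ 2 by decide)

theorem inner_t_t (hf : IsPrincipalFrame Γ n x t b κt κb) : inner ℝ t t = 1 := by
  rw [real_inner_self_eq_norm_sq, show ‖t‖ = 1 from hf.orthonormal.1 1, one_pow]

theorem inner_b_b (hf : IsPrincipalFrame Γ n x t b κt κb) : inner ℝ b b = 1 := by
  rw [real_inner_self_eq_norm_sq, show ‖b‖ = 1 from hf.orthonormal.1 2, one_pow]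

theorem tangentProj_t (hf : IsPrincipalFrame Γ n x t b κt κb) : tangentProj n x t = t := by
  simp [tangentProj, hf.inner_normal_t]

theorem tangentProj_b (hf : IsPrincipalFrame Γ n x t b κt κb) : tangentProj n x b = b := by
  simp [tangentProj, hf.inner_normal_b]

theorem surfDiv_eq (hf : IsPrincipalFrame Γ n x t b κt κb) (h : IsSide D Γ n) (hx : x ∈ Γ)
    {w : E3 → E3} {L : E3 →L[ℝ] E3} (hw : HasFDerivWithinAt w L Γ x) :
    surfDiv Γ n w x = inner ℝ t (L t) + inner ℝ b (L b) := by
  obtain ⟨e, e0, e1, e2⟩ := hf.exists_orthonormalBasis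
  have hn : tangentProj n x (n x) = 0 := by simp [tangentProj, h.norm_normal hx]
  rw [surfDiv, h.surfDeriv_eq hx hw, LinearMap.trace_eq_sum_inner _ e, Fin.sum_univ_three]
  simp [e0, e1, e2, hn, hf.tangentProj_t, hf.tangentProj_b]

theorem derivNormal_t (hf : IsPrincipalFrame Γ n x t b κt κb) (h : IsSide D Γ n) (hx : x ∈ Γ)
    {N : E3 →L[ℝ] E3} (hn : HasFDerivWithinAt n N Γ x) : N t = κt • t := by
  simpa [h.surfDeriv_eq hx hn, hf.tangentProj_t] using hf.deriv_t

theorem derivNormal_b (hf : IsPrincipalFrame Γ n x t b κt κb) (h : IsSide D Γ n) (hx : x ∈ Γ)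
    {N : E3 →L[ℝ] E3} (hn : HasFDerivWithinAt n N Γ x) : N b = κb • b := by
  simpa [h.surfDeriv_eq hx hn, hf.tangentProj_b] using hf.deriv_b

theorem totalCurvature_eq (hf : IsPrincipalFrame Γ n x t b κt κb) (h : IsSide D Γ n)
    (hx : x ∈ Γ) : totalCurvature Γ n x = κt + κb := by
  have hn := (h.differentiableWithinAt_normal hx).hasFDerivWithinAt
  rw [totalCurvature, hf.surfDiv_eq h hx hn, hf.derivNormal_t h hx hn, hf.derivNormal_b h hx hn,
    inner_smul_right, inner_smul_right, hf.inner_t_t, hf.inner_b_b, mul_one, mul_one]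

/-- The surface Laplacian as the tangential part of the Laplacian minus a curvature term. -/
theorem surfVecLaplacian_eq (hf : IsPrincipalFrame Γ n x t b κt κb) (h : IsSide D Γ n)
    (hx : x ∈ Γ) {q : E3 → E3} {A : E3 → E3 →L[ℝ] E3} {B : E3 →L[ℝ] E3 →L[ℝ] E3}
    (hq : ∀ y ∈ Γ, HasFDerivWithinAt q (A y) Γ y) (hA : HasFDerivWithinAt A B Γ x) :
    surfVecLaplacian Γ n q x = B t t + B b b - (κt + κb) • A x (n x) := by
  have hn := (h.differentiableWithinAt_normal hx).hasFDerivWithinAt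
  ext i
  obtain ⟨L, hL, hLi⟩ := exists_hasFDerivWithinAt_surfGrad h hx hq hA hn i
  have h1 : inner ℝ t (n x) = 0 := by rw [real_inner_comm, hf.inner_normal_t]
  have h2 : inner ℝ b (n x) = 0 := by rw [real_inner_comm, hf.inner_normal_b]
  simp only [surfVecLaplacian, surfLaplacian, hf.surfDiv_eq h hx hL, hLi,
    hf.derivNormal_t h hx hn, hf.derivNormal_b h hx hn, inner_smul_right, hf.inner_t_t,
    hf.inner_b_b, h1, h2, PiLp.add_apply, PiLp.sub_apply, PiLp.smul_apply, smul_eq_mul]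
  ring

/-- The surface divergence of the traction on one side of the interface. -/
theorem exists_traction_surfDiv (hf : IsPrincipalFrame Γ n x t b κt κb) (h : IsSide D Γ n)
    (hx : x ∈ Γ) {P : E3 → ℝ} {π : E3 →L[ℝ] ℝ} (hP : HasFDerivWithinAt P π Γ x)
    {A : E3 → E3 →L[ℝ] E3} {B : E3 →L[ℝ] E3 →L[ℝ] E3} (hA : HasFDerivWithinAt A B Γ x) (m : ℝ) :
    ∃ L : E3 →L[ℝ] E3,
      HasFDerivWithinAt (fun y => -(P y • n y) +
        m • (A y (n y) + ContinuousLinearMap.adjoint (A y) (n y))) L Γ x ∧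
      inner ℝ t (L t) + inner ℝ b (L b) = -(P x * (κt + κb)) +
        m * (inner ℝ t (B t (n x)) + inner ℝ b (B b (n x)) +
          inner ℝ (n x) (B t t) + inner ℝ (n x) (B b b) +
          2 * (κt * inner ℝ t (A x t) + κb * inner ℝ b (A x b))) := by
  have hn := (h.differentiableWithinAt_normal hx).hasFDerivWithinAt
  obtain ⟨L, hL, hLi⟩ := exists_hasFDerivWithinAt_traction hP hA hn m
  have h1 : inner ℝ t (n x) = 0 := by rw [real_inner_comm, hf.inner_normal_t]
  have h2 : inner ℝ b (n x) = 0 := by rw [real_inner_comm, hf.inner_normal_b]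
  refine ⟨L, hL, ?_⟩
  -- Tangential derivatives of `P` drop out because they multiply `n`. The curvature terms from `A
  -- n` and `Aᵀ n` coincide, giving the factor 2.
  simp only [hLi, hf.derivNormal_t h hx hn, hf.derivNormal_b h hx hn, inner_smul_right,
    map_smul, hf.inner_t_t, hf.inner_b_b, h1, h2, real_inner_comm (A x t) t,
    real_inner_comm (A x b) b, real_inner_comm (B t t) (n x), real_inner_comm (B b b) (n x)]
  ring

end IsPrincipalFrame

/-! ### One-sided limits and jumps -/

theorem IsSide.tendsto_stress {D Γ : Set E3} {n : E3 → E3} (h : IsSide D Γ n) {x : E3}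
    (hx : x ∈ Γ) {m : ℝ} {μ p P : E3 → ℝ} {u W : E3 → E3} (hμ : ∀ y ∈ D, μ y = m)
    (hP : ContinuousOn P (D ∪ Γ)) (hp : EqOn p P D) (hW : ContDiffOn ℝ 1 W (D ∪ Γ))
    (hu : EqOn u W D) (v : E3) :
    Tendsto (fun ε : ℝ => stress μ p u (x + ε • n x) v) (𝓝[>] 0)
      (𝓝 (-(P x • v) + m • (fderivWithin ℝ W (D ∪ Γ) x v +
        ContinuousLinearMap.adjoint (fderivWithin ℝ W (D ∪ Γ) x) v))) := by
  have hW1 := h.continuousOn_fderivWithin hW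
  refine h.tendsto_of_eqOn (w := fun y => stress μ p u y v) (W := fun y => -(P y • v) +
    m • (fderivWithin ℝ W (D ∪ Γ) y v +
      ContinuousLinearMap.adjoint (fderivWithin ℝ W (D ∪ Γ) y) v)) hx ?_ fun y hy => ?_
  · exact (hP.smul continuousOn_const).neg.add (((hW1.clm_apply continuousOn_const).add
      ((ContinuousLinearMap.adjoint.continuous.comp_continuousOn hW1).clm_apply
        continuousOn_const)).const_smul m)
  · simp [stress, hμ y hy, hp hy, h.fderiv_eqOn hu hy]

theorem IsSide.tendsto_smul_laplacian {D Γ : Set E3} {n : E3 → E3} (h : IsSide D Γ n) {x : E3}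
    (hx : x ∈ Γ) {m : ℝ} {μ : E3 → ℝ} {u W : E3 → E3} (hμ : ∀ y ∈ D, μ y = m)
    (hW : ContDiffOn ℝ 2 W (D ∪ Γ)) (hu : EqOn u W D) {ι : Type*} [Fintype ι]
    (e : OrthonormalBasis ι ℝ E3) :
    Tendsto (fun ε : ℝ => μ (x + ε • n x) • Laplacian.laplacian u (x + ε • n x)) (𝓝[>] 0)
      (𝓝 (m • ∑ i, fderivWithin ℝ (fderivWithin ℝ W (D ∪ Γ)) (D ∪ Γ) x (e i) (e i))) := by
  have hW2 := h.continuousOn_fderivWithin (h.contDiffOn_fderivWithin hW)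
  refine h.tendsto_of_eqOn (w := fun y => μ y • Laplacian.laplacian u y) (W := fun y =>
    m • ∑ i, fderivWithin ℝ (fderivWithin ℝ W (D ∪ Γ)) (D ∪ Γ) y (e i) (e i)) hx ?_
    fun y hy => ?_
  · exact (continuousOn_finsetSum _ fun i _ => (hW2.clm_apply continuousOn_const).clm_apply
      continuousOn_const).const_smul m
  · simp only [hμ y hy, h.laplacian_eqOn hu e hy]

theorem IsSide.tendsto_fderiv {D Γ : Set E3} {n : E3 → E3} (h : IsSide D Γ n) {x : E3}
    (hx : x ∈ Γ) {F : Type*} [NormedAddCommGroup F] [NormedSpace ℝ F] {p P : E3 → F}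
    (hP : ContDiffOn ℝ 1 P (D ∪ Γ)) (hp : EqOn p P D) :
    Tendsto (fun ε : ℝ => fderiv ℝ p (x + ε • n x)) (𝓝[>] 0)
      (𝓝 (fderivWithin ℝ P (D ∪ Γ) x)) :=
  h.tendsto_of_eqOn hx (h.continuousOn_fderivWithin hP) (h.fderiv_eqOn hp)

/-- A field continuous across the interface agrees there with its one-sided extensions. -/
theorem IsSide.eq_of_continuousAt {D Γ : Set E3} {n : E3 → E3} (h : IsSide D Γ n) {x : E3}
    (hx : x ∈ Γ) {F : Type*} [TopologicalSpace F] [T2Space F] {u W : E3 → F}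
    (hW : ContinuousOn W (D ∪ Γ)) (hu : EqOn u W D) (hc : ContinuousAt u x) : u x = W x :=
  tendsto_nhds_unique (hc.tendsto.comp (tendsto_add_smul x (n x))) (h.tendsto_of_eqOn hx hW hu)

theorem HasJump.unique {F : Type*} [NormedAddCommGroup F] {w : E3 → F} {x ν : E3}
    {J K : F} (hJ : HasJump w x ν J) (hK : HasJump w x ν K) : J = K := by
  obtain ⟨a, b, ha, hb, rfl⟩ := hJ
  obtain ⟨a', b', ha', hb', rfl⟩ := hK
  rw [tendsto_nhds_unique ha ha', tendsto_nhds_unique hb hb']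

theorem HasJump.of_tendsto {n : E3 → E3} {F : Type*}
    [NormedAddCommGroup F] {w : E3 → F} {x : E3} {a c : F}
    (ha : Tendsto (fun ε : ℝ => w (x + ε • n x)) (𝓝[>] 0) (𝓝 a))
    (hc : Tendsto (fun ε : ℝ => w (x + ε • -n x)) (𝓝[>] 0) (𝓝 c)) :
    HasJump w x (n x) (a - c) :=
  ⟨a, c, ha, by simpa only [smul_neg, ← sub_eq_add_neg] using hc, rfl⟩

/-! ### Assembly of the two jump formulas -/

theorem mainTheorem1 (Ω Ωm Ωp Γ : Set E3) (n : E3 → E3)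
    (hΓ : IsTwoPhaseDomain Ω Ωm Ωp Γ n)
    (μm μp : ℝ) (μ : E3 → ℝ) (u : E3 → E3) (p : E3 → ℝ) (g f q : E3 → E3)
    (hflow : IsStokesFlow Ω Ωm Ωp Γ n μm μp μ u p g f q)
    (x : E3) (hx : x ∈ Γ) :
    -- the surface derivatives in the second formula exist
    DifferentiableWithinAt ℝ n Γ x ∧
    DifferentiableWithinAt ℝ f Γ x ∧
    DifferentiableWithinAt ℝ q Γ x ∧
    (∀ i : Fin 3, DifferentiableWithinAt ℝ (surfGrad Γ n (fun y => q y i)) Γ x) ∧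
    -- the jumps of `∂p/∂n`, `μ ∇²u` and `g` exist and satisfy both formulas
    ∃ (dpdn : ℝ) (lapJump gJump : E3),
      HasJump (fun y => fderiv ℝ p y (n x)) x (n x) dpdn ∧
      HasJump (fun y => μ y • Laplacian.laplacian u y) x (n x) lapJump ∧
      HasJump g x (n x) gJump ∧
      dpdn = inner ℝ lapJump (n x) + inner ℝ gJump (n x) ∧
      ∀ (t b : E3) (κt κb : ℝ), IsPrincipalFrame Γ n x t b κt κb →
        dpdn = 2 * (μp - μm) *
              (inner ℝ (n x) (surfVecLaplacian Γ n q x)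
                + κt * inner ℝ (surfDeriv Γ n q x t) t
                + κb * inner ℝ (surfDeriv Γ n q x b) b)
            - surfDiv Γ n f x
            + inner ℝ (f x) (n x) * totalCurvature Γ n x
            + inner ℝ gJump (n x) := by
  have hp := hΓ.isSide_plus
  have hm := hΓ.isSide_minus
  obtain ⟨⟨um, hum, eum⟩, up, hup, eup⟩ := hflow.velocity_regular
  obtain ⟨⟨pm, hpm, epm⟩, pp, hpp, epp⟩ := hflow.pressure_regular
  norm_cast at hum hup hpm hpp
  have hup1 : ContDiffOn ℝ 1 up (Ωp ∪ Γ) := hup.of_le (by norm_num)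
  have hum1 : ContDiffOn ℝ 1 um (Ωm ∪ Γ) := hum.of_le (by norm_num)
  have hΓΩ : Γ ⊆ Ω := by
    rw [hΓ.interface_eq]
    exact frontier_subset_closure.trans hΓ.closure_minus_subset
  have hqp : ∀ y ∈ Γ, q y = up y := fun y hy => (hflow.interface_velocity y hy).trans <|
    hp.eq_of_continuousAt hy hup.continuousOn eup
      (hflow.velocity_continuous.continuousAt (hΓ.isOpen.mem_nhds (hΓΩ hy)))
  have hqm : ∀ y ∈ Γ, q y = um y := fun y hy => (hflow.interface_velocity y hy).trans <|
    hm.eq_of_continuousAt hy hum.continuousOn eum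
      (hflow.velocity_continuous.continuousAt (hΓ.isOpen.mem_nhds (hΓΩ hy)))
  have hdqp : ∀ y ∈ Γ, HasFDerivWithinAt q (fderivWithin ℝ up (Ωp ∪ Γ) y) Γ y := fun y hy =>
    (IsSide.hasFDerivWithinAt hup1 hy).congr hqp (hqp y hy)
  have hdqm : ∀ y ∈ Γ, HasFDerivWithinAt q (fderivWithin ℝ um (Ωm ∪ Γ) y) Γ y := fun y hy =>
    (IsSide.hasFDerivWithinAt hum1 hy).congr hqm (hqm y hy)
  have hAp := IsSide.hasFDerivWithinAt (hp.contDiffOn_fderivWithin hup) hx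
  have hAm := IsSide.hasFDerivWithinAt (hm.contDiffOn_fderivWithin hum) hx
  have hPp := IsSide.hasFDerivWithinAt hpp hx
  have hPm := IsSide.hasFDerivWithinAt hpm hx
  have hn := (hp.differentiableWithinAt_normal hx).hasFDerivWithinAt
  -- Uniqueness of jumps identifies `f` with the traction difference on all of `Γ`, which makes it
  -- differentiable along `Γ`.
  have hf : ∀ y ∈ Γ, f y =
      (-(pp y • n y) + μp • (fderivWithin ℝ up (Ωp ∪ Γ) y (n y) +
        ContinuousLinearMap.adjoint (fderivWithin ℝ up (Ωp ∪ Γ) y) (n y))) -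
      (-(pm y • n y) + μm • (fderivWithin ℝ um (Ωm ∪ Γ) y (n y) +
        ContinuousLinearMap.adjoint (fderivWithin ℝ um (Ωm ∪ Γ) y) (n y))) := fun y hy =>
    (hflow.stress_balance y hy).unique <| HasJump.of_tendsto
      (hp.tendsto_stress hy hflow.viscosity_plus hpp.continuousOn epp hup1 eup (n y))
      (hm.tendsto_stress hy hflow.viscosity_minus hpm.continuousOn epm hum1 eum (n y))
  have hlap : ∀ e : OrthonormalBasis (Fin 3) ℝ E3,
      HasJump (fun y => μ y • Laplacian.laplacian u y) x (n x) _ := fun e =>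
    HasJump.of_tendsto (hp.tendsto_smul_laplacian hx hflow.viscosity_plus hup eup e)
      (hm.tendsto_smul_laplacian hx hflow.viscosity_minus hum eum e)
  have hdpp := hp.tendsto_fderiv hx hpp epp
  have hdpm := hm.tendsto_fderiv hx hpm epm
  have e₀ := EuclideanSpace.basisFun (Fin 3) ℝ
  have hlp := hp.tendsto_smul_laplacian hx hflow.viscosity_plus hup eup e₀
  have hlm := hm.tendsto_smul_laplacian hx hflow.viscosity_minus hum eum e₀
  -- The momentum equation expresses `g` through `p` and `u`, so its one-sided limits exist without
  -- any regularity assumption on `g`.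
  have hg : ∀ y ∈ Ωm ∪ Ωp, gradient p y - μ y • Laplacian.laplacian u y = g y := fun y hy =>
    sub_eq_iff_eq_add'.2 (hflow.momentum y hy)
  have hgrad := (toDual ℝ E3).symm.continuous
  have hgp := (((hgrad.tendsto _).comp hdpp).sub hlp).congr'
    ((hp.eventually_mem hx).mono fun ε hε => hg _ (Or.inr hε))
  have hgm := (((hgrad.tendsto _).comp hdpm).sub hlm).congr'
    ((hm.eventually_mem hx).mono fun ε hε => hg _ (Or.inl hε))
  have hpn := HasJump.of_tendsto (w := fun y => fderiv ℝ p y (n x))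
    (((ContinuousLinearMap.apply ℝ ℝ (n x)).continuous.tendsto _).comp hdpp)
    (((ContinuousLinearMap.apply ℝ ℝ (n x)).continuous.tendsto _).comp hdpm)
  simp only [ContinuousLinearMap.apply_apply] at hpn
  have hfirst : ∀ {α β : E3 →L[ℝ] ℝ} {lp lm : E3}, α (n x) - β (n x) =
      inner ℝ (lp - lm) (n x) + inner ℝ
        (((toDual ℝ E3).symm α - lp) - ((toDual ℝ E3).symm β - lm)) (n x) := by
    intro α β lp lm
    simp only [inner_sub_left, toDual_symm_apply]
    ring
  refine ⟨hn.differentiableWithinAt, ?_, (hdqp x hx).differentiableWithinAt, fun i => ?_,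
    _, _, _, hpn, hlap e₀, HasJump.of_tendsto hgp hgm, hfirst, fun t b κt κb hF => ?_⟩
  · obtain ⟨Lp, hLp, -⟩ := exists_hasFDerivWithinAt_traction hPp hAp hn μp
    obtain ⟨Lm, hLm, -⟩ := exists_hasFDerivWithinAt_traction hPm hAm hn μm
    exact ((hLp.sub hLm).congr hf (hf x hx)).differentiableWithinAt
  · obtain ⟨L, hL, -⟩ := exists_hasFDerivWithinAt_surfGrad hp hx hdqp hAp hn i
    exact hL.differentiableWithinAt
  -- The first formula replaces the pressure jump; cancelling the jump of `g` leaves an identity for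
  -- [μ Δu]·n.
  refine (hfirst (lp := _) (lm := _)).trans ((add_left_inj _).2 ?_)
  obtain ⟨e, e0, e1, e2⟩ := hF.exists_orthonormalBasis
  -- The jump was produced in a basis chosen before the frame was given; uniqueness allows its
  -- expansion in the frame.
  rw [(hlap e₀).unique (hlap e)]
  obtain ⟨Lp, hLp, dLp⟩ := hF.exists_traction_surfDiv hp hx hPp hAp μp
  -- The plus side `hp` serves for the minus traction too: it only supplies the geometry of `Γ` with
  -- its normal `n`.
  obtain ⟨Lm, hLm, dLm⟩ := hF.exists_traction_surfDiv hp hx hPm hAm μm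
  have hdivf := hF.surfDiv_eq hp hx ((hLp.sub hLm).congr hf (hf x hx))
  have hdivp : ∀ y ∈ Ωp, _ := fun y hy => hflow.incompressible y (Or.inr hy)
  have hdivm : ∀ y ∈ Ωm, _ := fun y hy => hflow.incompressible y (Or.inl hy)
  have tBp := hp.sum_inner_fderivWithin_fderivWithin_eq_zero hup eup hdivp e hx (n x)
  have tBm := hm.sum_inner_fderivWithin_fderivWithin_eq_zero hum eum hdivm e hx (n x)
  have lapp := congrArg (inner ℝ (n x)) <| hF.surfVecLaplacian_eq hp hx hdqp hAp
  have lapm := congrArg (inner ℝ (n x)) <| hF.surfVecLaplacian_eq hp hx hdqm hAm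
  have hsp := hp.fderivWithin_fderivWithin_symm hup hx
  have hsm := hm.fderivWithin_fderivWithin_symm hum hx
  have qtp : surfDeriv Γ n q x t = fderivWithin ℝ up (Ωp ∪ Γ) x t := by
    simp [hp.surfDeriv_eq hx (hdqp x hx), hF.tangentProj_t]
  have qtm : surfDeriv Γ n q x t = fderivWithin ℝ um (Ωm ∪ Γ) x t := by
    simp [hp.surfDeriv_eq hx (hdqm x hx), hF.tangentProj_t]
  have qbp : surfDeriv Γ n q x b = fderivWithin ℝ up (Ωp ∪ Γ) x b := by
    simp [hp.surfDeriv_eq hx (hdqp x hx), hF.tangentProj_b]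
  have qbm : surfDeriv Γ n q x b = fderivWithin ℝ um (Ωm ∪ Γ) x b := by
    simp [hp.surfDeriv_eq hx (hdqm x hx), hF.tangentProj_b]
  rw [← qtp, ← qbp] at dLp
  rw [← qtm, ← qbm] at dLm
  have hnn : inner ℝ (n x) (n x) = (1 : ℝ) := by
    rw [real_inner_self_eq_norm_sq, hp.norm_normal hx, one_pow]
  rw [hdivf, hF.totalCurvature_eq hp hx, hf x hx]
  generalize fderivWithin ℝ (fderivWithin ℝ up (Ωp ∪ Γ)) (Ωp ∪ Γ) x = Bp at *
  generalize fderivWithin ℝ (fderivWithin ℝ um (Ωm ∪ Γ)) (Ωm ∪ Γ) x = Bm at *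
  generalize fderivWithin ℝ up (Ωp ∪ Γ) x = Ap at *
  generalize fderivWithin ℝ um (Ωm ∪ Γ) x = Am at *
  simp only [Fin.sum_univ_three, e0, e1, e2] at tBp tBm ⊢
  rw [hsp (n x) t, hsp (n x) b] at tBp
  rw [hsm (n x) t, hsm (n x) b] at tBm
  simp only [inner_add_right, inner_sub_right, inner_smul_right] at lapp lapm
  simp only [real_inner_comm (n x), real_inner_comm t (surfDeriv Γ n q x t),
    real_inner_comm b (surfDeriv Γ n q x b), sub_apply, inner_add_right,
    inner_sub_right, inner_neg_right, inner_smul_right, hnn,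
    ContinuousLinearMap.adjoint_inner_right]
  -- On each side `tB` trades n·B(n,n) for the mixed terms, `dL` turns these into ∇_s·F, and twice
  -- `lap` absorbs n·B(t,t) + n·B(b,b).
  linear_combination μp * tBp - μm * tBm - 2 * μp * lapp + 2 * μm * lapm + dLp - dLm
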